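/- **Setting.** Let $f_p:\mathbb{R}^{n_x}\times\mathbb{R}^{n_u}\to\mathbb{R}^{n_x}$ be continuously differentiable with $f_p(0,0)=0$, let $\kappa:\mathbb{R}^{n_x}\to\mathbb{R}^{n_u}$, and put $f(x,e)=f_p(x,\kappa(x+e))$, $g(x,e)=-f(x,e)$. A *dropout sequence* is a binary sequence $\nu=(\nu_k)_{k\in\mathbb{N}_0}$; $\nu_k=1$ means that a new input is received at time $kh$, where $h>0$ is the sampling period. Always $\nu_0=1$ is assumed. Let $0=\tau_0<\tau_1<\dots$ be the times $kh$ with $\nu_k=1$. The closed-loop system with dropout sequence $\nu$ is $$\dot x=f(x,e),\quad \dot e=g(x,e)\quad (\tau_z\le t<\tau_{z+1}),\qquad x(\tau_{z+1})=x(\tau_{z+1}^-),\quad e(\tau_{z+1})=0\quad (z\in\mathbb{N}_0),$$ with $x(0)=x_0$ and $e(0)=0$. Its origin is *globally asymptotically stable* if from every $x_0$ there is a trajectory on $[0,\infty)$; for every $\beta>0$ there is $\delta>0$ such that every trajectory $\xi=(x,e)$ with $\|\xi(0)\|\le\delta$ satisfies $\|\xi(t)\|\le\beta$ for all $t\ge0$;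 and $\xi(t)\to0$ as $t\to\infty$ for every trajectory $\xi$. **Constraints and graphs.** A *constraint* $\eta$ is a map from binary sequences to $\{\text{true},\text{false}\}$; $\nu\vdash\eta$ means $\eta(\nu)=\text{true}$; $\eta'$ is *harder* than $\eta$, $\eta'\preceq\eta$, if $\nu\vdash\eta'$ implies $\nu\vdash\eta$. Let $w(\eta)\in\mathbb{N}_0\cup\{\infty\}$ be the maximal number of consecutive zeros in a sequence $\nu\vdash\eta$. A finite labeled directed graph $\mathcal{G}$, whose edges carry positive integer weights $l_p$, is a *WHRT graph* for $\eta$ if every $\nu\vdash\eta$ with $\nu_0=1$ is of the form $\nu=(1\,0^{l_{p_1}-1}\,1\,0^{l_{p_2}-1}\,1\dots)$ for an infinite walk $(p_1,p_2,\dots)$ of $\mathcal{G}$. The cost of a finite walk is the sum of its edge weights, and $\mathcal{S}(\mathcal{G},c)$ is the set of finite walks of cost at least $c$ whose cost falls below $c$ when the last edge is removed. **Assumption 1** (for $V:\mathbb{R}^{n_x}\to\mathbb{R}$). $V$ is locally Lipschitz and positive definite, and there are $\underline\alpha_V,\overline\alpha_V\in\mathcal{K}_\infty$ with $\underline\alpha_V(\|x\|)\le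 V(x)\le\overline\alpha_V(\|x\|)$ and $\langle\nabla V(x),f_p(x,\kappa(x))\rangle<0$ for all $x\ne0$. **Assumption 2** (for $(\gamma,L,\epsilon)$ and $V$). $\gamma,L>0$, $\epsilon\in\mathbb{R}$, and there are a locally Lipschitz $W:\mathbb{R}^{n_x}\to\mathbb{R}_{\ge0}$, a continuous $H:\mathbb{R}^{n_x}\to\mathbb{R}_{\ge0}$ and $\underline\alpha_W,\overline\alpha_W\in\mathcal{K}_\infty$ such that for all $x,e$: $\underline\alpha_W(\|e\|)\le W(e)\le\overline\alpha_W(\|e\|)$, $\langle\nabla W^2(e),g(x,e)\rangle\le2W(e)(LW(e)+H(x))$ and $\langle\nabla V(x),f(x,e)\rangle\le-\epsilon V(x)-H(x)^2+\gamma^2W(e)^2$. Inequalities on $\nabla V$ or $\nabla W^2$ are required at those points where the gradient exists. For $\gamma,\Lambda>0$ and $r=\sqrt{|(\gamma/\Lambda)^2-1|}$ let $$T_{\max}(\gamma,\Lambda)=\begin{cases}\frac1{\Lambda r}\arctan r&\gamma>\Lambda,\\ \frac1\Lambda&\gamma=\Lambda,\\ \frac1{\Lambda r}\operatorname{arctanh}r&\gamma<\Lambda.\end{cases}$$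 **Theorem.** Let $h>0$, let $\mathcal{G}_\eta$ be a WHRT graph for a constraint $\eta$, let $c_{\mathrm{walk}}\ge1$ be an integer, and let Assumption 1 hold for $V$. Let real numbers $\gamma_i,L_i,\Lambda_i,\epsilon_i$ $(i\ge1)$ be given such that, for each integer $i$ with $1\le i\le w(\eta)+1$, Assumption 2 holds for $(\gamma_i,L_i,\epsilon_i)$ and $V$ (with $W$ and $H$ that may depend on $i$), $\Lambda_i>0$, and $ih<T_{\max}(\gamma_i,\Lambda_i)$. Suppose that for each walk $P\in\mathcal{S}(\mathcal{G}_\eta,c_{\mathrm{walk}})$ with edge weights $l_1,\dots,l_{n_P}$, $$\sum_{\theta=1}^{n_P}h\,l_\theta\max\{-\epsilon_{l_\theta},\,2(L_{l_\theta}-\Lambda_{l_\theta})\}<0 .$$ Then for every constraint $\eta'\preceq\eta$ and every $\nu\vdash\eta'$ with $\nu_0=1$, the origin of the closed-loop system with dropout sequence $\nu$ is globally asymptotically stable. -/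

import Mathlib

open Set Filter Topology
open scoped NNReal

noncomputable section

namespace WHRT

/-- `ℝⁿ` with the Euclidean norm. -/
abbrev Vec (n : ℕ) : Type := EuclideanSpace ℝ (Fin n)

/-! ### Comparison functions -/

/-- Class `𝒦`: continuous, strictly increasing functions `ℝ≥0 → ℝ≥0` that vanish at `0`. -/
def IsClassK (α : ℝ≥0 → ℝ≥0) : Prop :=
  Continuous α ∧ StrictMono α ∧ α 0 = 0

/-- Class `𝒦∞`: unbounded class `𝒦` functions. -/
def IsClassKInf (α : ℝ≥0 → ℝ≥0) : Prop :=
  IsClassK α ∧ ¬ BddAbove (range α)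

/-- A continuous function that vanishes at the origin and is positive elsewhere. -/
def IsPosDef {n : ℕ} (V : Vec n → ℝ) : Prop :=
  Continuous V ∧ V 0 = 0 ∧ ∀ x, x ≠ 0 → 0 < V x

/-! ### Dropout sequences, weakly hard real-time constraints and graphs

A dropout sequence is a map `ν : ℕ → Bool`, where `ν k = true` says that a new input is received at
the sampling instant `k`. -/

/-- A constraint says which infinite binary sequences satisfy it. -/
abbrev Constraint : Type := (ℕ → Bool) → Prop

/-- `η'` is harder than `η`: every sequence that satisfies `η'` satisfies `η`. -/
def Harder (η' η : Constraint) : Prop := ∀ ν, η' ν → η ν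

/-- The maximal number of consecutive lost transmissions in a sequence that satisfies `η`
(`⊤` if there is no bound). -/
def maxLost (η : Constraint) : ℕ∞ :=
  sSup {m : ℕ∞ | ∃ (ν : ℕ → Bool) (k n : ℕ), η ν ∧ (∀ j < n, ν (k + j) = false) ∧ m = n}

/-- A finite labeled directed graph; the labels (weights) of the edges are positive integers. -/
structure LabeledDigraph where
  numNodes : ℕ
  numEdges : ℕ
  src : Fin numEdges → Fin numNodes
  tgt : Fin numEdges → Fin numNodes
  weight : Fin numEdges → ℕ
  weight_pos : ∀ p, 0 < weight p

namespace LabeledDigraph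

variable (G : LabeledDigraph)

/-- A finite walk, given by its sequence of edge indices: every edge starts at the node at which
the previous one ends. -/
def IsWalk (P : List (Fin G.numEdges)) : Prop :=
  P.IsChain fun a b => G.tgt a = G.src b

/-- An infinite walk, given by its sequence of edge indices. -/
def IsInfWalk (P : ℕ → Fin G.numEdges) : Prop :=
  ∀ k, G.tgt (P k) = G.src (P (k + 1))

/-- The cost of a finite walk: the sum of its edge weights. -/
def cost (P : List (Fin G.numEdges)) : ℕ := (P.map G.weight).sum

/-- The walks of cost at least `c` whose cost drops below `c` when the last edge is removed. -/
def walksOfCost (c : ℕ) : Set (List (Fin G.numEdges)) :=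
  {P | G.IsWalk P ∧ c ≤ G.cost P ∧ G.cost P.dropLast < c}

/-- The sequence `ν` is `1 0…0 1 0…0 1 …`, where the `j`-th block `1 0…0` has as its length the
weight of the `j`-th edge of `P`; that is, the ones are exactly at the partial sums of weights. -/
def Generates (P : ℕ → Fin G.numEdges) (ν : ℕ → Bool) : Prop :=
  ∀ k, ν k = true ↔ ∃ j, k = ∑ i ∈ Finset.range j, G.weight (P i)

/-- `G` is a WHRT graph for `η`: every sequence that satisfies `η` (and starts with a successful
transmission) is generated by an infinite walk of `G`. -/
def IsWHRTGraph (η : Constraint) : Prop :=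
  ∀ ν, η ν → ν 0 = true → ∃ P, G.IsInfWalk P ∧ G.Generates P ν

end LabeledDigraph

/-! ### The closed loop -/

section ClosedLoop

variable {nx nu : ℕ} (fp : Vec nx → Vec nu → Vec nx) (κ : Vec nx → Vec nu)

/-- The vector field of the state `x`. -/
def f (x e : Vec nx) : Vec nx := fp x (κ (x + e))

/-- The vector field of the sampling error `e`. -/
def g (x e : Vec nx) : Vec nx := - fp x (κ (x + e))

/-- The time `τ_z` of the `z`-th successful transmission (counted from `z = 0`): `h` times the
`z`-th index `k` with `ν k = true`. -/
def transTime (h : ℝ) (ν : ℕ → Bool) (z : ℕ) : ℝ := h * (Nat.nth (fun k => ν k = true) z : ℝ)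

/-- `(x, e)` is a trajectory on `[0, ∞)` of the closed loop with inputs received at the times
`τ 0 < τ 1 < …`: it flows along `(f, g)` on every interval `[τ z, τ (z + 1))`, and at `τ (z + 1)`
the state is continuous and the error is reset to `0`. -/
structure IsTrajectory (τ : ℕ → ℝ) (x₀ : Vec nx) (x e : ℝ → Vec nx) : Prop where
  init_x : x 0 = x₀
  init_e : e 0 = 0
  flow_x : ∀ z, ∀ t ∈ Ico (τ z) (τ (z + 1)),
    HasDerivWithinAt x (f fp κ (x t) (e t)) (Ico (τ z) (τ (z + 1))) t
  flow_e : ∀ z, ∀ t ∈ Ico (τ z) (τ (z + 1)),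
    HasDerivWithinAt e (g fp κ (x t) (e t)) (Ico (τ z) (τ (z + 1))) t
  jump_x : ∀ z, Tendsto x (𝓝[<] (τ (z + 1))) (𝓝 (x (τ (z + 1))))
  jump_e : ∀ z, e (τ (z + 1)) = 0

/-- The stacked vector `ξ = [x; e]` in `ℝ^{2 nx}` with its Euclidean norm. -/
def stack (x e : Vec nx) : WithLp 2 (Vec nx × Vec nx) := WithLp.toLp 2 (x, e)

/-- Global asymptotic stability of the origin: from every initial state there is a trajectory on
`[0, ∞)`, the origin is stable, and every trajectory converges to the origin. -/
def IsGAS (τ : ℕ → ℝ) : Prop :=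
  (∀ x₀, ∃ x e, IsTrajectory fp κ τ x₀ x e) ∧
  (∀ β > (0 : ℝ), ∃ δ > (0 : ℝ), ∀ x₀ x e, IsTrajectory fp κ τ x₀ x e →
    ‖stack (x 0) (e 0)‖ ≤ δ → ∀ t ≥ (0 : ℝ), ‖stack (x t) (e t)‖ ≤ β) ∧
  (∀ x₀ x e, IsTrajectory fp κ τ x₀ x e →
    Tendsto (fun t => stack (x t) (e t)) atTop (𝓝 0))

/-! ### Assumptions on the closed loop

The functions `V` and `W ^ 2` are locally Lipschitz, hence have a gradient almost everywhere; an
inequality on the gradient is required at every point at which it exists. -/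

/-- The continuous-time feedback `κ` is stabilizing, with Lyapunov function `V`. -/
structure StabilizingFeedback (V : Vec nx → ℝ) : Prop where
  locLip : LocallyLipschitz V
  posDef : IsPosDef V
  bounds : ∃ αl αu : ℝ≥0 → ℝ≥0, IsClassKInf αl ∧ IsClassKInf αu ∧
    ∀ x, x ≠ 0 → (αl ‖x‖₊ : ℝ) ≤ V x ∧ V x ≤ (αu ‖x‖₊ : ℝ)
  decrease : ∀ x, x ≠ 0 → ∀ p, HasGradientAt V p x → inner ℝ p (fp x (κ x)) < 0

/-- The emulation assumption on the sampled loop for the parameters `γ`, `L`, `ε`, where `V` is the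
Lyapunov function of the continuous-time loop. -/
def EmulationAssumption (V : Vec nx → ℝ) (γ L ε : ℝ) : Prop :=
  0 < γ ∧ 0 < L ∧
  ∃ W H : Vec nx → ℝ, LocallyLipschitz W ∧ (∀ e, 0 ≤ W e) ∧ Continuous H ∧ (∀ x, 0 ≤ H x) ∧
    (∃ αl αu : ℝ≥0 → ℝ≥0, IsClassKInf αl ∧ IsClassKInf αu ∧
      ∀ e, (αl ‖e‖₊ : ℝ) ≤ W e ∧ W e ≤ (αu ‖e‖₊ : ℝ)) ∧
    (∀ x e q, HasGradientAt (fun e' => W e' ^ 2) q e →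
      inner ℝ q (g fp κ x e) ≤ 2 * W e * (L * W e + H x)) ∧
    (∀ x e p, HasGradientAt V p x →
      inner ℝ p (f fp κ x e) ≤ - ε * V x - H x ^ 2 + γ ^ 2 * W e ^ 2)

end ClosedLoop

/-- The bound on the time between two received inputs, with `r = √|(γ/Λ)² - 1|`. -/
def Tmax (γ Λ : ℝ) : ℝ :=
  let r := √|(γ / Λ) ^ 2 - 1|
  if Λ < γ then 1 / (Λ * r) * Real.arctan r
  else if γ = Λ then 1 / Λ
  else 1 / (Λ * r) * Real.artanh r

end WHRT

end

noncomputable section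

namespace WHRT

/-! ### Dini derivatives of locally Lipschitz functions -/

/-! Between transmissions the input is held: `x + e` keeps its value `s` at the start `a` of the
interval, so `e = s - x`. Consider `U = V(x) + γ φ(t - a) W(s - x)²`, where `φ > 0` solves `φ' =
-2Λφ - γ(φ² + 1)`. Adding the two emulation inequalities and completing a square leaves `U' ≤ -ε V +
2(L - Λ) γ φ W² - (H - γ φ W)²`, hence `U' ≤ m U` with `m = max (-ε) (2 (L - Λ))`. Since `W 0 = 0`,
`U` starts at `V s`, and `V` grows at most at rate `m` (`storage_bound`). The bound `Tmax` is what
keeps a positive `φ` alive over the whole interval (`exists_riccati`).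

Only `V` is carried across a transmission, so `γ, L, ε, W, H` may change with the interval length.
Individual rates may be positive, but the exponents add up along the walk generating `ν`. There are
finitely many walks of cost about `c`, so each such block contributes at most some uniform `-δ`, and
the exponents fall linearly (`exists_sum_le_sub_mul`). Thus `V` decays exponentially in the number
of transmissions, which gives stability and attractivity (`isGAS_of_holdRate`).

`V` and `W²` are only locally Lipschitz, so the differential inequality is one for Dini derivatives
(`eventually_slope_lt_of_gradient_le`). -/

lemma sub_le_mul_of_ae_deriv_le {u : ℝ → ℝ} {K : ℝ≥0} (hu : LipschitzWith K u) {t r : ℝ}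
    (ht : 0 ≤ t) (h : ∀ᵐ s, s ∈ Icc 0 t → deriv u s ≤ r) : u t - u 0 ≤ r * t := by
  have hac : AbsolutelyContinuousOnInterval u 0 t :=
    (hu.lipschitzOnWith (s := uIcc 0 t)).absolutelyContinuousOnInterval
  rw [← hac.integral_deriv_eq_sub]
  have hle : ∫ s in (0 : ℝ)..t, deriv u s ≤ ∫ _ in (0 : ℝ)..t, r := by
    refine intervalIntegral.integral_mono_ae_restrict ht hac.intervalIntegrable_deriv
      intervalIntegrable_const ?_
    rwa [EventuallyLE, MeasureTheory.ae_restrict_iff' measurableSet_Icc]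
  refine hle.trans_eq ?_
  simp [mul_comm]

section Dini

variable {E : Type*} [NormedAddCommGroup E] [InnerProductSpace ℝ E] [FiniteDimensional ℝ E]

/-- The segment from `x` may miss every point of differentiability. By Rademacher and Fubini,
however, for almost every `y` the line through `y` along `v` meets almost only such points. There
the bound follows by integration; these `y` are dense, and continuity carries it to `x`. Shrinking
the ball by `t * ‖v‖` keeps the segments inside radius `ρ`. -/
lemma lipschitz_sub_le_of_gradient_le {φ : E → ℝ} {K : ℝ≥0} (hφ : LipschitzWith K φ) {x v : E}
    {ρ r t : ℝ} (ht : 0 ≤ t) (htv : t * ‖v‖ < ρ)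
    (h : ∀ y ∈ Metric.ball x ρ, ∀ p, HasGradientAt φ p y → inner ℝ p v ≤ r) :
    φ (x + t • v) - φ x ≤ r * t := by
  let : MeasurableSpace E := borel E
  have : BorelSpace E := ⟨rfl⟩
  have hae : ∀ᵐ y : E, ∀ᵐ s : ℝ, y + s • v ∈ {z | DifferentiableAt ℝ φ z} := by
    have := (MeasureTheory.ae_ae_add_linearMap_mem_iff (LinearMap.toSpanSingleton ℝ E v)
      MeasureTheory.volume MeasureTheory.volume
      (measurableSet_of_differentiableAt ℝ φ)).2 (hφ.ae_differentiableAt)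
    simpa [LinearMap.toSpanSingleton_apply] using this
  have hdense := MeasureTheory.Measure.dense_of_ae hae
  have hx : x ∈ Metric.ball x (ρ - t * ‖v‖) := Metric.mem_ball_self (by linarith)
  have hcl := hdense.open_subset_closure_inter Metric.isOpen_ball hx
  have hclosed : IsClosed {y | φ (y + t • v) - φ y ≤ r * t} := by
    have := hφ.continuous
    exact isClosed_le (by fun_prop) continuous_const
  refine closure_minimal ?_ hclosed hcl
  rintro y ⟨hy, hyd⟩
  obtain ⟨C, hC⟩ : ∃ C, LipschitzWith C fun s : ℝ => φ (y + s • v) := by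
    refine ⟨K * ‖v‖₊, LipschitzWith.of_dist_le_mul fun a b => ?_⟩
    refine (hφ.dist_le_mul _ _).trans_eq ?_
    rw [dist_add_left, dist_eq_norm, ← sub_smul, norm_smul, dist_eq_norm]
    push_cast
    ring
  have := sub_le_mul_of_ae_deriv_le hC ht (r := r) ?_
  · simpa using this
  filter_upwards [hyd] with s hs hst
  have hs' : DifferentiableAt ℝ φ (y + s • v) := hs
  have hd : HasDerivAt (fun s : ℝ => y + s • v) v s := by
    simpa using ((hasDerivAt_id s).smul_const v).const_add y
  have hg := hs'.hasGradientAt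
  have := hg.hasFDerivAt.comp_hasDerivAt s hd
  have hder : deriv (fun s : ℝ => φ (y + s • v)) s = inner ℝ (gradient φ (y + s • v)) v := by
    rw [← InnerProductSpace.toDual_apply_apply]
    exact this.deriv
  rw [hder]
  refine h _ ?_ _ hg
  rw [Metric.mem_ball] at hy ⊢
  calc dist (y + s • v) x ≤ dist (y + s • v) y + dist y x := dist_triangle _ _ _
    _ < t * ‖v‖ + (ρ - t * ‖v‖) := by
        refine add_lt_add_of_le_of_lt ?_ hy
        rw [dist_self_add_left, norm_smul, Real.norm_of_nonneg hst.1]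
        exact mul_le_mul_of_nonneg_right hst.2 (norm_nonneg _)
    _ = ρ := by ring

lemma norm_gradient_le_of_lipschitz {φ : E → ℝ} {K : ℝ≥0} (hφ : LipschitzWith K φ) {p y : E}
    (h : HasGradientAt φ p y) : ‖p‖ ≤ K := by
  have := h.hasFDerivAt.le_of_lipschitz hφ
  simpa using this

/-- If `⟨∇V, F⟩ ≤ a` wherever the gradient of the locally Lipschitz function `V` exists, then the
upper right Dini derivative of `V` along a curve with right derivative `F` is at most `a`. -/
lemma eventually_slope_lt_of_gradient_le {V a : E → ℝ} {F : E → E} (hV : LocallyLipschitz V)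
    (ha : Continuous a) (hF : Continuous F)
    (h : ∀ y p, HasGradientAt V p y → inner ℝ p (F y) ≤ a y)
    {x : ℝ → E} {t r : ℝ} (hx : HasDerivWithinAt x (F (x t)) (Ioi t) t) (hr : a (x t) < r) :
    ∀ᶠ z in 𝓝[>] t, (z - t)⁻¹ * (V (x z) - V (x t)) < r := by
  obtain ⟨K, s, hs, hK⟩ := hV (x t)
  obtain ⟨ψ, hψ, hψV⟩ := hK.extend_real
  obtain ⟨q, hq, hqr⟩ := exists_between hr
  set v := F (x t) with hv
  -- Freezing the direction at `v` costs at most `K * ‖v - F y‖`, since gradients are bounded by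
  -- `K`; this is negligible near `x t`.
  have hcont : Continuous fun y => a y + K * ‖v - F y‖ := by fun_prop
  have hlt : ∀ᶠ y in 𝓝 (x t), a y + K * ‖v - F y‖ < q :=
    hcont.continuousAt.eventually_lt_const (by simpa [← hv] using hq)
  obtain ⟨ρ, hρ, hball⟩ := Metric.mem_nhds_iff.1 (hlt.and hs)
  have hgrad : ∀ y ∈ Metric.ball (x t) ρ, ∀ p, HasGradientAt ψ p y → inner ℝ p v ≤ q := by
    intro y hy p hp
    have hev : V =ᶠ[𝓝 y] ψ := by
      filter_upwards [Metric.isOpen_ball.mem_nhds hy] with z hz using hψV (hball hz).2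
    have h1 := h y p (hp.congr_of_eventuallyEq hev)
    have h2 : inner ℝ p (v - F y) ≤ K * ‖v - F y‖ :=
      (real_inner_le_norm _ _).trans
        (mul_le_mul_of_nonneg_right (norm_gradient_le_of_lipschitz hψ hp) (norm_nonneg _))
    rw [inner_sub_right] at h2
    linarith [(hball hy).1]
  -- Tolerance for the deviation of `x` from its tangent: after multiplication by `K` it must fit
  -- into the gap `r - q`. The `+ 1` covers `K = 0`.
  have hη : 0 < (r - q) / (K + 1) := div_pos (by linarith) (by positivity)
  have hsmall := (hasDerivWithinAt_iff_isLittleO.1 hx).def hη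
  have hxc : Tendsto x (𝓝[>] t) (𝓝 (x t)) := hx.continuousWithinAt
  have hxs : ∀ᶠ z in 𝓝[>] t, x z ∈ s := hxc hs
  have hz0 : ∀ᶠ z in 𝓝[>] t, (z - t) * ‖v‖ < ρ := by
    have : Tendsto (fun z => (z - t) * ‖v‖) (𝓝[>] t) (𝓝 ((t - t) * ‖v‖)) :=
      ((continuous_id.sub continuous_const).mul continuous_const).continuousWithinAt
    exact this.eventually_lt_const (by simpa using hρ)
  filter_upwards [hsmall, hxs, hz0, self_mem_nhdsWithin] with z h1 h2 h3 hz
  have hzt : 0 < z - t := sub_pos.2 hz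
  rw [hψV h2, hψV (mem_of_mem_nhds hs)]
  have hdir := lipschitz_sub_le_of_gradient_le hψ hzt.le h3 hgrad
  have hd := (le_abs_self _).trans (hψ.dist_le_mul (x z) (x t + (z - t) • v))
  rw [dist_eq_norm] at hd
  have h1' : ‖x z - (x t + (z - t) • v)‖ ≤ (r - q) / (K + 1) * (z - t) := by
    rw [Real.norm_of_nonneg hzt.le] at h1
    rwa [← sub_sub]
  have h4 : K * ‖x z - (x t + (z - t) • v)‖ < (r - q) * (z - t) := by
    have hK0 : (0 : ℝ) ≤ K := K.2
    calc _ ≤ K * ((r - q) / (K + 1) * (z - t)) := mul_le_mul_of_nonneg_left h1' hK0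
      _ < (K + 1) * ((r - q) / (K + 1) * (z - t)) :=
        mul_lt_mul_of_pos_right (by linarith) (mul_pos hη hzt)
      _ = _ := by field_simp
  rw [inv_mul_lt_iff₀ hzt]
  linarith

end Dini

/-! ### The Riccati equation behind `Tmax` -/

/-- The substitution `φ = γ S / (C - Λ S)`, run backward in time, linearizes the Riccati equation.
-/
lemma exists_riccati_of_linear {γ Λ T₀ T : ℝ} (hγ : 0 < γ) (hT : T < T₀) (hT₀ : 0 < T₀)
    {S C : ℝ → ℝ} (hS : ∀ s, HasDerivAt S (C s) s)
    (hC : ∀ s, HasDerivAt C ((Λ ^ 2 - γ ^ 2) * S s) s)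
    (hpos : ∀ s, 0 < s → s < T₀ → 0 < S s ∧ 0 < C s - Λ * S s) :
    ∃ φ : ℝ → ℝ, ∀ t ∈ Icc 0 T,
      0 < φ t ∧ HasDerivAt φ (-2 * Λ * φ t - γ * (φ t ^ 2 + 1)) t := by
  -- Any `T₁` strictly between `max T 0` and `T₀` keeps `T₁ - t` in `(0, T₀)` for all `t ∈ Icc 0 T`.
  set T₁ := (max T 0 + T₀) / 2 with hT₁
  have hmax : max T 0 < T₀ := max_lt hT hT₀
  refine ⟨fun t => γ * S (T₁ - t) / (C (T₁ - t) - Λ * S (T₁ - t)), fun t ht => ?_⟩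
  have h1 : 0 < T₁ - t := by have := le_max_left T 0; linarith [ht.2]
  have h2 : T₁ - t < T₀ := by linarith [ht.1]
  obtain ⟨p1, p2⟩ := hpos _ h1 h2
  refine ⟨by positivity, ?_⟩
  have hsub : HasDerivAt (fun t => T₁ - t) (-1) t := by
    simpa using (hasDerivAt_id t).const_sub T₁
  have dS := (hS (T₁ - t)).comp t hsub
  have dC := (hC (T₁ - t)).comp t hsub
  have hd := (dS.const_mul γ).div (dC.sub (dS.const_mul Λ)) p2.ne'
  refine hd.congr_deriv ?_
  simp only [Function.comp_apply, Pi.sub_apply]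
  generalize S (T₁ - t) = s at *
  generalize C (T₁ - t) = c at *
  have hne := p2.ne'
  field_simp
  ring

/-- With `ω = Λ r`, the solutions `S` are `sinh (ω s) / ω`, `s` and `sin (ω s) / ω`. In each case
`Tmax` is the first positive zero of `C - Λ S`, that is, of `tanh (ω s) = r`, `Λ s = 1` or `tan (ω
s) = r`. -/
lemma exists_riccati {γ Λ T : ℝ} (hγ : 0 < γ) (hΛ : 0 < Λ) (hT : T < Tmax γ Λ) :
    ∃ φ : ℝ → ℝ, ∀ t ∈ Icc 0 T,
      0 < φ t ∧ HasDerivAt φ (-2 * Λ * φ t - γ * (φ t ^ 2 + 1)) t := by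
  have hmul : ∀ ω s : ℝ, HasDerivAt (fun s => ω * s) ω s := fun ω s => by
    simpa using (hasDerivAt_id s).const_mul ω
  rcases lt_trichotomy γ Λ with hlt | heq | hgt
  · have hq : γ / Λ < 1 := (div_lt_one hΛ).2 hlt
    have hq0 : 0 < γ / Λ := div_pos hγ hΛ
    set r := √|(γ / Λ) ^ 2 - 1| with hr
    have hr2 : r ^ 2 = 1 - (γ / Λ) ^ 2 := by
      rw [hr, Real.sq_sqrt (abs_nonneg _), abs_of_nonpos (by nlinarith)]
      ring
    have hr0 : 0 < r := Real.sqrt_pos.2 (abs_pos.2 (by nlinarith))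
    have hr1 : r < 1 := by nlinarith
    have hω : (Λ * r) ^ 2 = Λ ^ 2 - γ ^ 2 := by
      rw [mul_pow, hr2]; field_simp
    set ω := Λ * r with hωdef
    have hω0 : 0 < ω := mul_pos hΛ hr0
    have hTm : Tmax γ Λ = 1 / ω * Real.artanh r := by
      simp only [Tmax, if_neg hlt.not_gt, if_neg hlt.ne]
      rfl
    rw [hTm] at hT
    refine exists_riccati_of_linear (S := fun s => Real.sinh (ω * s) / ω)
      (C := fun s => Real.cosh (ω * s)) hγ hT
      (mul_pos (by positivity) (Real.artanh_pos ⟨hr0, hr1⟩)) (fun s => ?_) (fun s => ?_)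
      (fun s hs hs' => ?_)
    · refine (((hmul ω s).sinh).div_const ω).congr_deriv ?_
      field_simp
    · refine ((hmul ω s).cosh).congr_deriv ?_
      rw [← hω]; field_simp
    · have h1 : ω * s < Real.artanh r := by
        rwa [one_div, inv_mul_eq_div, lt_div_iff₀' hω0] at hs'
      have h2 : Real.tanh (ω * s) < r := by
        by_contra! hcon
        have := Real.artanh_le_artanh (by linarith) (Real.tanh_lt_one _) hcon
        rw [Real.artanh_tanh] at this
        linarith
      rw [Real.tanh_eq_sinh_div_cosh, div_lt_iff₀ (Real.cosh_pos _)] at h2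
      refine ⟨div_pos (Real.sinh_pos_iff.2 (mul_pos hω0 hs)) hω0, ?_⟩
      have : Λ * (Real.sinh (ω * s) / ω) = Real.sinh (ω * s) / r := by
        rw [hωdef]; field_simp
      rw [this, sub_pos, div_lt_iff₀ hr0]
      linarith
  · subst heq
    have hTm : Tmax γ γ = 1 / γ := by simp [Tmax]
    rw [hTm] at hT
    refine exists_riccati_of_linear (S := fun s => s) (C := fun _ => 1) hγ hT (by positivity)
      (fun s => hasDerivAt_id s) (fun s => ?_) (fun s hs hs' => ⟨hs, ?_⟩)
    · simpa using hasDerivAt_const s (1 : ℝ)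
    · rw [lt_div_iff₀' hγ] at hs'
      linarith
  · have hq : 1 < γ / Λ := (one_lt_div hΛ).2 hgt
    set r := √|(γ / Λ) ^ 2 - 1| with hr
    have hr2 : r ^ 2 = (γ / Λ) ^ 2 - 1 := by
      rw [hr, Real.sq_sqrt (abs_nonneg _), abs_of_nonneg (by nlinarith)]
    have hr0 : 0 < r := Real.sqrt_pos.2 (abs_pos.2 (by nlinarith))
    have hω : (Λ * r) ^ 2 = γ ^ 2 - Λ ^ 2 := by
      rw [mul_pow, hr2]; field_simp
    set ω := Λ * r with hωdef
    have hω0 : 0 < ω := mul_pos hΛ hr0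
    have hTm : Tmax γ Λ = 1 / ω * Real.arctan r := by
      simp only [Tmax, if_pos hgt]
      rfl
    rw [hTm] at hT
    have hω' : Λ ^ 2 - γ ^ 2 = -ω ^ 2 := by rw [hω]; ring
    refine exists_riccati_of_linear (S := fun s => Real.sin (ω * s) / ω)
      (C := fun s => Real.cos (ω * s)) hγ hT
      (mul_pos (by positivity) (Real.arctan_pos.2 hr0)) (fun s => ?_) (fun s => ?_)
      (fun s hs hs' => ?_)
    · refine (((hmul ω s).sin).div_const ω).congr_deriv ?_
      field_simp
    · refine ((hmul ω s).cos).congr_deriv ?_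
      rw [hω']; field_simp
    · have h1 : ω * s < Real.arctan r := by
        rwa [one_div, inv_mul_eq_div, lt_div_iff₀' hω0] at hs'
      have h0 : 0 < ω * s := mul_pos hω0 hs
      have hpi := Real.arctan_lt_pi_div_two r
      have hcos : 0 < Real.cos (ω * s) :=
        Real.cos_pos_of_mem_Ioo ⟨by linarith [Real.pi_pos], h1.trans hpi⟩
      have h2 : Real.tan (ω * s) < r := by
        rw [← Real.tan_arctan r]
        exact Real.tan_lt_tan_of_lt_of_lt_pi_div_two (by linarith [Real.pi_pos]) hpi h1
      rw [Real.tan_eq_sin_div_cos, div_lt_iff₀ hcos] at h2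
      refine ⟨div_pos (Real.sin_pos_of_pos_of_lt_pi h0 (by linarith [Real.pi_pos])) hω0, ?_⟩
      have : Λ * (Real.sin (ω * s) / ω) = Real.sin (ω * s) / r := by
        rw [hωdef]; field_simp
      rw [this, sub_pos, div_lt_iff₀ hr0]
      linarith

/-! ### Decay of the Lyapunov function over one sampling interval -/

section Storage

variable {nx nu : ℕ} {fp : Vec nx → Vec nu → Vec nx} {κ : Vec nx → Vec nu} {V : Vec nx → ℝ}

lemma StabilizingFeedback.nonneg (hV : StabilizingFeedback fp κ V) (x : Vec nx) : 0 ≤ V x := by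
  rcases eq_or_ne x 0 with rfl | hx
  · exact hV.posDef.2.1.ge
  · exact (hV.posDef.2.2 x hx).le

lemma storage_bound (hfp : Continuous fun y : Vec nx × Vec nu => fp y.1 y.2)
    (hV : StabilizingFeedback fp κ V) {γ L ε Λ T : ℝ} (hem : EmulationAssumption fp κ V γ L ε)
    (hΛ : 0 < Λ) (hT : T < Tmax γ Λ) {x : ℝ → Vec nx} {a b : ℝ} (hab : b - a ≤ T)
    (hc : ContinuousOn x (Icc a b))
    (hx : ∀ t ∈ Ico a b, HasDerivWithinAt x (fp (x t) (κ (x a))) (Ioi t) t) :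
    ∀ t ∈ Icc a b, V (x t) ≤ V (x a) * Real.exp (max (-ε) (2 * (L - Λ)) * (t - a)) := by
  obtain ⟨hγ, -, W, H, hW, hW0, hH, -, ⟨αl, αu, -, hαu, hWb⟩, hdW, hdV⟩ := hem
  obtain ⟨φ, hφ⟩ := exists_riccati hγ hΛ hT
  have hWz : W 0 = 0 := by
    refine le_antisymm ?_ (hW0 0)
    simpa [hαu.1.2.2] using (hWb 0).2
  set s := x a with hs
  have hVc := hV.locLip.continuous
  have hWc := hW.continuous
  have hfpu : Continuous fun y => fp y (κ s) := hfp.comp (continuous_id.prodMk continuous_const)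
  have hφp : ∀ t ∈ Icc a b, t - a ∈ Icc 0 T := fun t ht =>
    ⟨by linarith [ht.1], by linarith [ht.2]⟩
  set U : ℝ → ℝ := fun t => V (x t) + γ * φ (t - a) * W (s - x t) ^ 2 with hU
  set aV : Vec nx → ℝ := fun y => -ε * V y - H y ^ 2 + γ ^ 2 * W (s - y) ^ 2 with haV
  set aW : Vec nx → ℝ := fun e => 2 * W e * (L * W e + H (s - e)) with haW
  set dφ : ℝ → ℝ := fun t => -2 * Λ * φ (t - a) - γ * (φ (t - a) ^ 2 + 1) with hdφ
  have hφd : ∀ t ∈ Icc a b, HasDerivAt (fun t => φ (t - a)) (dφ t) t := fun t ht =>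
    ((hφ _ (hφp t ht)).2).comp_sub_const t a
  have hUc : ContinuousOn U (Icc a b) := by
    have hφc : ContinuousOn (fun t => φ (t - a)) (Icc a b) := fun t ht =>
      (hφd t ht).continuousAt.continuousWithinAt
    refine (hVc.comp_continuousOn hc).add ((continuousOn_const.mul hφc).mul ?_)
    exact (hWc.comp_continuousOn (continuousOn_const.sub hc)).pow 2
  have hW2 : LocallyLipschitz fun e => W e ^ 2 :=
    (contDiff_id.pow 2 : ContDiff ℝ 1 fun y : ℝ => y ^ 2).locallyLipschitz.comp hW
  have key := le_gronwallBound_of_liminf_deriv_right_le (δ := V s)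
    (K := max (-ε) (2 * (L - Λ))) (ε := 0)
    (f' := fun t => aV (x t) + γ * φ (t - a) * aW (s - x t) + γ * W (s - x t) ^ 2 * dφ t)
    hUc ?_ ?_ ?_
  · intro t ht
    have := key t ht
    rw [gronwallBound_ε0, mul_comm _ (t - a), mul_comm (t - a)] at this
    refine le_trans ?_ this
    have := (hφ _ (hφp t ht)).1
    simp only [hU]
    have : 0 ≤ γ * φ (t - a) * W (s - x t) ^ 2 := by positivity
    linarith
  · intro t ht r hr
    refine Eventually.frequently ?_
    have hφt := (hφ _ (hφp t (Ico_subset_Icc_self ht))).1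
    set D := aV (x t) + γ * φ (t - a) * aW (s - x t) + γ * W (s - x t) ^ 2 * dφ t with hD
    -- Slack allowed in each of the two Dini bounds; together they raise `D` by `d * (1 + γ φ) = (r
    -- - D) / 2`.
    set d := (r - D) / (2 * (1 + γ * φ (t - a))) with hd
    have hd0 : 0 < d := div_pos (sub_pos.2 hr) (by positivity)
    have e1 := eventually_slope_lt_of_gradient_le (F := fun y => fp y (κ s)) hV.locLip
      (a := aV) (by fun_prop) hfpu
      (fun y p hp => by simpa [f, haV] using hdV y (s - y) p hp) (hx t ht)
      (lt_add_of_pos_right _ hd0)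
    have e2 := eventually_slope_lt_of_gradient_le (V := fun e => W e ^ 2)
      (F := fun e => -fp (s - e) (κ s)) hW2
      (a := aW) (by fun_prop) (hfpu.comp (continuous_const.sub continuous_id)).neg
      (fun e p hp => by simpa [g, haW] using hdW (s - e) e p hp) (x := fun t => s - x t)
      (t := t) (by simpa using (hx t ht).const_sub s)
      (lt_add_of_pos_right _ hd0)
    have e3 : Tendsto (fun z => φ (z - a)) (𝓝[>] t) (𝓝 (φ (t - a))) :=
      (hφd t (Ico_subset_Icc_self ht)).continuousAt.continuousWithinAt
    have e4 : Tendsto (slope (fun t => φ (t - a)) t) (𝓝[>] t) (𝓝 (dφ t)) :=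
      (hasDerivWithinAt_iff_tendsto_slope' self_notMem_Ioi).1
        (hφd t (Ico_subset_Icc_self ht)).hasDerivWithinAt
    -- Discrete product rule: the increment of `φ W²` is `φ` at `z` times the increment of `W²`,
    -- plus `W²` at `t` times the increment of `φ`.
    have e5 : ∀ᶠ z in 𝓝[>] t, (aV (x t) + d) + γ * φ (z - a) * (aW (s - x t) + d)
        + γ * W (s - x t) ^ 2 * slope (fun t => φ (t - a)) t z < r := by
      refine Tendsto.eventually_lt_const (v := (aV (x t) + d) +
        γ * φ (t - a) * (aW (s - x t) + d) + γ * W (s - x t) ^ 2 * dφ t) ?_ ?_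
      · have : d * (1 + γ * φ (t - a)) = (r - D) / 2 := by rw [hd]; field_simp
        linarith
      · exact ((e3.const_mul γ).mul_const _).const_add _ |>.add (e4.const_mul _)
    filter_upwards [e1, e2, e3.eventually_const_lt hφt, e5] with z h1 h2 h3 h5
    have h6 := mul_le_mul_of_nonneg_left h2.le (mul_nonneg hγ.le h3.le)
    refine lt_of_le_of_lt ?_ h5
    rw [slope_def_field, div_eq_inv_mul]
    simp only [hU]
    linear_combination h1 + h6
  · simp [hU, ← hs, hWz]
  · intro t ht
    have hφt := (hφ _ (hφp t (Ico_subset_Icc_self ht))).1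
    have hm1 := mul_le_mul_of_nonneg_right (le_max_left (-ε) (2 * (L - Λ))) (hV.nonneg (x t))
    have hm2 := mul_le_mul_of_nonneg_right (le_max_right (-ε) (2 * (L - Λ)))
      (show 0 ≤ γ * φ (t - a) * W (s - x t) ^ 2 by positivity)
    simp only [hU, haV, haW, hdφ, sub_sub_cancel, add_zero]
    -- The Riccati terms `-γ²(φ² + 1) W²` cancel `γ² W²` and complete this square.
    have := sq_nonneg (H (x t) - γ * φ (t - a) * W (s - x t))
    linarith

/-! ### Existence of solutions with an a priori bound -/

/-- A cutoff equal to `1` on the ball of radius `R + 1` makes the field bounded and globally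
Lipschitz, so a solution exists on all of `[0, T]`. Up to the first time its norm reached `R + 1` it
would solve the original equation, and the a priori bound `R` forbids this. -/
lemma exists_solution_of_bounded {E : Type*} [NormedAddCommGroup E] [InnerProductSpace ℝ E]
    [FiniteDimensional ℝ E] {F : E → E} (hF : ContDiff ℝ 1 F) (x₀ : E) {T : ℝ} (hT : 0 ≤ T)
    {R : ℝ} (hR : ∀ (x : ℝ → E) (b : ℝ), 0 ≤ b → b ≤ T → x 0 = x₀ → ContinuousOn x (Icc 0 b) →
      (∀ t ∈ Ico 0 b, HasDerivWithinAt x (F (x t)) (Ioi t) t) → ∀ t ∈ Icc 0 b, ‖x t‖ ≤ R) :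
    ∃ x : ℝ → E, x 0 = x₀ ∧ ∀ t ∈ Icc 0 T, HasDerivWithinAt x (F (x t)) (Icc 0 T) t := by
  have hR0 : 0 ≤ R := by
    refine (norm_nonneg x₀).trans (hR (fun _ => x₀) 0 le_rfl hT rfl continuousOn_const
      (by simp) 0 (by simp))
  let χ : ContDiffBump (0 : E) := ⟨R + 1, R + 2, by linarith, by linarith⟩
  set G : E → E := fun y => χ y • F y with hG
  have hGs : ContDiff ℝ 1 G := χ.contDiff.smul hF
  have hGc : HasCompactSupport G := χ.hasCompactSupport.smul_right
  obtain ⟨K, hK⟩ := hGs.lipschitzWith_of_hasCompactSupport hGc one_ne_zero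
  obtain ⟨M, hM⟩ := hGc.exists_bound_of_continuous hGs.continuous
  have hM0 : 0 ≤ M := (norm_nonneg _).trans (hM 0)
  lift M to ℝ≥0 using hM0
  have hpl : IsPicardLindelof (fun _ => G) (tmin := 0) (tmax := T) ⟨0, by simp [hT]⟩ x₀
      (M * T.toNNReal) 0 M K :=
    { lipschitzOnWith := fun _ _ => hK.lipschitzOnWith
      continuousOn := fun _ _ => continuousOn_const
      norm_le := fun _ _ y _ => hM y
      mul_max_le := by simp [hT] }
  obtain ⟨x, hx0, hx⟩ := hpl.exists_eq_forall_mem_Icc_hasDerivWithinAt₀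
  have hx0' : x 0 = x₀ := hx0
  have hxc : ContinuousOn x (Icc 0 T) := fun t ht => (hx t ht).continuousWithinAt
  have hGF : ∀ y, ‖y‖ ≤ R + 1 → G y = F y := fun y hy => by
    simp only [hG]
    rw [χ.one_of_mem_closedBall (by simpa using hy), one_smul]
  have hbound : ∀ t ∈ Icc 0 T, ‖x t‖ < R + 1 := by
    by_contra! hcon
    obtain ⟨t₁, ht₁, hge⟩ := hcon
    set S := Icc 0 T ∩ (fun t => ‖x t‖) ⁻¹' Ici (R + 1) with hS
    have hSc : IsCompact S :=
      isCompact_Icc.of_isClosed_subset (hxc.norm.preimage_isClosed_of_isClosed isClosed_Icc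
        isClosed_Ici) inter_subset_left
    obtain ⟨b, hb, hleast⟩ := hSc.exists_isLeast ⟨t₁, ht₁, hge⟩
    have hlt : ∀ t ∈ Ico 0 b, ‖x t‖ < R + 1 := fun t ht => by
      by_contra! h
      exact absurd (hleast ⟨⟨ht.1, ht.2.le.trans hb.1.2⟩, h⟩) ht.2.not_ge
    have := hR x b hb.1.1 hb.1.2 hx0' (hxc.mono (Icc_subset_Icc_right hb.1.2))
      (fun t ht => by
        rw [← hGF _ (hlt t ht).le]
        have htT : t < T := ht.2.trans_le hb.1.2
        refine (hx t ⟨ht.1, htT.le⟩).mono_of_mem_nhdsWithin ?_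
        exact mem_of_superset (Ioo_mem_nhdsGT htT) fun z hz => ⟨ht.1.trans hz.1.le, hz.2.le⟩)
      b ⟨hb.1.1, le_rfl⟩
    have h2 : R + 1 ≤ ‖x b‖ := hb.2
    linarith
  exact ⟨x, hx0', fun t ht => by rw [← hGF _ (hbound t ht).le]; exact hx t ht⟩

end Storage

/-! ### Infinite walks and the dropout sequences they generate -/

lemma sum_map_range {M : Type*} [AddCommMonoid M] (a : ℕ → M) (n : ℕ) :
    ((List.range n).map a).sum = ∑ i ∈ Finset.range n, a i := by
  induction n with
  | zero => simp
  | succ n ih => simp [List.range_succ, Finset.sum_range_succ, ih]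

namespace LabeledDigraph

variable {G : LabeledDigraph} {P : ℕ → Fin G.numEdges} {ν : ℕ → Bool}

variable (G P) in
lemma strictMono_sum_weight :
    StrictMono fun z => ∑ i ∈ Finset.range z, G.weight (P i) :=
  strictMono_nat_of_lt_succ fun z => by
    rw [Finset.sum_range_succ]
    exact Nat.lt_add_of_pos_right (G.weight_pos _)

lemma Generates.nth_eq_sum (h : G.Generates P ν) (z : ℕ) :
    Nat.nth (fun k => ν k = true) z = ∑ i ∈ Finset.range z, G.weight (P i) := by
  have hmono := strictMono_sum_weight G P
  have hset : Set.ofPred (fun k => ν k = true) =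
      range fun z => ∑ i ∈ Finset.range z, G.weight (P i) := by
    ext k
    exact (h k).trans ⟨fun ⟨j, hj⟩ => ⟨j, hj.symm⟩, fun ⟨j, hj⟩ => ⟨j, hj.symm⟩⟩
  have hinf : (Set.ofPred fun k => ν k = true).Infinite := by
    rw [hset]
    exact infinite_range_of_injective hmono.injective
  have := (StrictMono.range_inj (Nat.nth_strictMono hinf) hmono).1
    ((Nat.range_nth_of_infinite hinf).trans hset)
  exact congrFun this z

/-- A block of weight `n + 1` holds `n` consecutive zeros: a one among them would be a partial sum
strictly between two successive ones. Hence the parameter assumptions cover every weight met along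
`P`. -/
lemma Generates.weight_le_maxLost (h : G.Generates P ν) {η : Constraint} (hν : η ν) (z : ℕ) :
    (G.weight (P z) : ℕ∞) ≤ maxLost η + 1 := by
  obtain ⟨n, hn⟩ := Nat.exists_eq_add_of_lt (G.weight_pos (P z))
  rw [zero_add] at hn
  have hmem : (n : ℕ∞) ≤ maxLost η := by
    refine le_sSup ⟨ν, ∑ i ∈ Finset.range z, G.weight (P i) + 1, n, hν, fun j hj => ?_, rfl⟩
    by_contra hcon
    rw [Bool.not_eq_false] at hcon
    obtain ⟨m, hm⟩ := (h _).1 hcon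
    have hmono := strictMono_sum_weight G P
    have h1 : z < m := hmono.lt_iff_lt.1 (by omega)
    have h2 : m < z + 1 := hmono.lt_iff_lt.1 (by
      simp only [Finset.sum_range_succ]; omega)
    omega
  rw [hn]
  push_cast
  gcongr

/-- Take the shortest prefix of cost at least `c`; positive weights bound its length by `c`. -/
lemma IsInfWalk.exists_walksOfCost (h : G.IsInfWalk P) {c : ℕ} (hc : 0 < c) :
    ∃ n, 0 < n ∧ n ≤ c ∧ (List.range n).map P ∈ G.walksOfCost c := by
  have hcost : ∀ n, G.cost ((List.range n).map P) = ∑ i ∈ Finset.range n, G.weight (P i) := by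
    intro n
    rw [cost, List.map_map, sum_map_range]
    rfl
  have hge : ∀ n, n ≤ ∑ i ∈ Finset.range n, G.weight (P i) :=
    fun n => (strictMono_sum_weight G P).le_apply
  have hex : ∃ n, c ≤ ∑ i ∈ Finset.range n, G.weight (P i) := ⟨c, hge c⟩
  obtain ⟨m, hm⟩ : ∃ m, Nat.find hex = m + 1 := by
    refine Nat.exists_eq_succ_of_ne_zero fun h0 => ?_
    have := Nat.find_spec hex
    rw [h0] at this
    simp at this
    omega
  have h1 := Nat.find_spec hex
  have h2 := Nat.find_min hex (m := m) (by omega)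
  rw [hm] at h1
  have h3 := hge m
  refine ⟨m + 1, m.succ_pos, by omega, ?_, ?_, ?_⟩
  · rw [IsWalk, List.isChain_map, List.isChain_range]
    exact fun k _ => h k
  · rwa [hcost]
  · rw [List.range_succ, List.map_append, List.map_singleton, List.dropLast_concat, hcost]
    omega

lemma finite_walksOfCost (G : LabeledDigraph) (c : ℕ) : (G.walksOfCost c).Finite := by
  refine (List.finite_length_le (Fin G.numEdges) c).subset fun P hP => ?_
  have hlen : ∀ Q : List (Fin G.numEdges), Q.length ≤ G.cost Q := fun Q => by
    induction Q with
    | nil => simp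
    | cons p Q ih =>
      have := G.weight_pos p
      simp only [cost, List.map_cons, List.sum_cons, List.length_cons] at ih ⊢
      omega
  have h1 := hlen P.dropLast
  have h2 := hP.2.2
  rw [List.length_dropLast] at h1
  change P.length ≤ c
  omega

/-- If the weights `a` have a negative sum along all walks of cost about `c`, then the partial sums
of `a` along infinite walks decrease at a uniform linear rate. -/
lemma exists_sum_le_sub_mul (G : LabeledDigraph) {c : ℕ} (hc : 0 < c) {a : Fin G.numEdges → ℝ}
    (ha : ∀ P ∈ G.walksOfCost c, (P.map a).sum < 0) :
    ∃ B : ℝ, ∃ d > 0, ∀ (N : ℕ) (P : ℕ → Fin G.numEdges), G.IsInfWalk P →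
      ∑ i ∈ Finset.range N, a (P i) ≤ B - d * N := by
  obtain ⟨δ, hδ, hδP⟩ : ∃ δ > 0, ∀ P ∈ G.walksOfCost c, (P.map a).sum ≤ -δ := by
    rcases (G.walksOfCost c).eq_empty_or_nonempty with he | hne
    · exact ⟨1, one_pos, by simp [he]⟩
    · obtain ⟨P, hP, hmax⟩ := (G.finite_walksOfCost c).exists_maximalFor
        (fun P => (P.map a).sum) _ hne
      refine ⟨-(P.map a).sum, by linarith [ha P hP], fun Q hQ => ?_⟩
      rw [neg_neg]
      exact (le_total _ _).elim id (hmax hQ)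
  obtain ⟨M, hM⟩ := (finite_range a).bddAbove
  have hcR : (0 : ℝ) < c := Nat.cast_pos.2 hc
  -- Prefixes of at most `c` edges are peeled off, each gaining `δ`, hence the rate `δ / c` per
  -- edge. The fewer than `c` leftover edges contribute at most `c * |M|`, and `δ` pays for their
  -- share of the linear term. The tail is another walk, so `P` stays general in the induction.
  refine ⟨c * |M| + δ, δ / c, div_pos hδ hcR, fun N => ?_⟩
  induction N using Nat.strong_induction_on with
  | _ N ih =>
    intro P hP
    rcases lt_or_ge N c with hN | hN
    · have hNc : (N : ℝ) ≤ c := by exact_mod_cast hN.le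
      have h1 : ∑ i ∈ Finset.range N, a (P i) ≤ N * |M| := by
        refine (Finset.sum_le_card_nsmul _ _ |M| fun i _ =>
          (hM (mem_range_self _)).trans (le_abs_self M)).trans_eq ?_
        simp
      have h2 : (N : ℝ) * |M| ≤ c * |M| := mul_le_mul_of_nonneg_right hNc (abs_nonneg _)
      have h3 : δ / c * N ≤ δ := by
        rw [div_mul_eq_mul_div, div_le_iff₀ hcR]
        exact mul_le_mul_of_nonneg_left hNc hδ.le
      linarith
    · obtain ⟨n, hn0, hnc, hmem⟩ := hP.exists_walksOfCost hc
      have h1 := hδP _ hmem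
      rw [List.map_map, Function.comp_def, sum_map_range] at h1
      obtain ⟨k, rfl⟩ := Nat.exists_eq_add_of_le (hnc.trans hN)
      have h2 := ih k (by omega) (fun i => P (n + i)) fun i => hP (n + i)
      rw [Finset.sum_range_add]
      have h3 : δ / c * n ≤ δ := by
        rw [div_mul_eq_mul_div, div_le_iff₀ hcR]
        exact mul_le_mul_of_nonneg_left (by exact_mod_cast hnc) hδ.le
      push_cast
      linarith

end LabeledDigraph

/-! ### Global asymptotic stability from decay over the sampling intervals -/

section Stability

variable {nx nu : ℕ} {fp : Vec nx → Vec nu → Vec nx} {κ : Vec nx → Vec nu} {V : Vec nx → ℝ}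

lemma norm_le_norm_stack (x e : Vec nx) : ‖x‖ ≤ ‖stack x e‖ := by
  rw [stack, WithLp.prod_norm_eq_of_L2]
  exact Real.le_sqrt_of_sq_le (le_add_of_nonneg_right (sq_nonneg _))

lemma norm_stack_le (x e : Vec nx) : ‖stack x e‖ ≤ ‖x‖ + ‖e‖ := by
  rw [stack, WithLp.prod_norm_eq_of_L2]
  refine Real.sqrt_le_iff.2 ⟨by positivity, ?_⟩
  change ‖x‖ ^ 2 + ‖e‖ ^ 2 ≤ _
  have := mul_nonneg (norm_nonneg x) (norm_nonneg e)
  linarith [add_sq ‖x‖ ‖e‖]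

namespace StabilizingFeedback

lemma exists_le_of_le_norm (hV : StabilizingFeedback fp κ V) : ∃ α : ℝ≥0 → ℝ≥0, IsClassKInf α ∧
    ∀ (r : ℝ≥0) (x : Vec nx), (r : ℝ) ≤ ‖x‖ → (α r : ℝ) ≤ V x := by
  obtain ⟨α, _, hα, -, hb⟩ := hV.bounds
  refine ⟨α, hα, fun r x hr => ?_⟩
  rcases eq_or_ne x 0 with rfl | hx
  · have : r = 0 := by
      rw [norm_zero] at hr
      exact le_antisymm (by exact_mod_cast hr) bot_le
    rw [this, hα.1.2.2, hV.posDef.2.1, NNReal.coe_zero]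
  · refine le_trans ?_ (hb x hx).1
    exact_mod_cast hα.1.2.1.monotone (show r ≤ ‖x‖₊ from hr)

lemma exists_norm_lt (hV : StabilizingFeedback fp κ V) {β : ℝ} (hβ : 0 < β) :
    ∃ ζ > 0, ∀ x, V x < ζ → ‖x‖ < β := by
  obtain ⟨α, hα, h⟩ := hV.exists_le_of_le_norm
  lift β to ℝ≥0 using hβ.le
  refine ⟨α β, ?_, fun x hx => lt_of_not_ge fun hn => (h β x hn).not_gt hx⟩
  have := hα.1.2.1 (show 0 < β from hβ)
  rw [hα.1.2.2] at this
  exact_mod_cast this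

lemma exists_norm_le (hV : StabilizingFeedback fp κ V) (v : ℝ) :
    ∃ R : ℝ, ∀ x, V x ≤ v → ‖x‖ ≤ R := by
  obtain ⟨α, hα, h⟩ := hV.exists_le_of_le_norm
  obtain ⟨_, ⟨r, rfl⟩, hr⟩ := not_bddAbove_iff.1 hα.2 v.toNNReal
  refine ⟨r, fun x hx => le_of_not_ge fun hn => ?_⟩
  have h1 := h r x hn
  have h2 : v < α r := (Real.le_coe_toNNReal v).trans_lt (NNReal.coe_lt_coe.2 hr)
  linarith

end StabilizingFeedback

variable (fp κ V) in
/-- Along solutions with held input, defined on an interval of length at most `T`, the function `V`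
grows at most at the rate `m`. -/
def HoldRate (T m : ℝ) : Prop :=
  ∀ (x : ℝ → Vec nx) (a b : ℝ), b - a ≤ T → ContinuousOn x (Icc a b) →
    (∀ t ∈ Ico a b, HasDerivWithinAt x (fp (x t) (κ (x a))) (Ioi t) t) →
    ∀ t ∈ Icc a b, V (x t) ≤ V (x a) * Real.exp (m * (t - a))

/-- The growth bound confines every solution to a sublevel set of `V`, which is bounded because the
lower comparison function is unbounded; finite escape is thus excluded. -/
lemma HoldRate.exists_solution (hfp : ContDiff ℝ 1 fun y : Vec nx × Vec nu => fp y.1 y.2)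
    (hV : StabilizingFeedback fp κ V) {T m : ℝ} (hT : 0 ≤ T) (hm : HoldRate fp κ V T m)
    (y : Vec nx) :
    ∃ x : ℝ → Vec nx, x 0 = y ∧
      ∀ t ∈ Icc 0 T, HasDerivWithinAt x (fp (x t) (κ y)) (Icc 0 T) t := by
  obtain ⟨R, hR⟩ := hV.exists_norm_le (V y * Real.exp (|m| * T))
  refine exists_solution_of_bounded (F := fun x => fp x (κ y))
    (hfp.comp (contDiff_id.prodMk contDiff_const)) y hT (R := R) fun x b _ hbT hx0 hc hd t ht => ?_
  subst hx0
  refine hR _ ((hm x 0 b (by simpa using hbT) hc hd t ht).trans ?_)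
  refine mul_le_mul_of_nonneg_left (Real.exp_le_exp.2 ?_) (hV.nonneg _)
  rw [sub_zero]
  exact mul_le_mul (le_abs_self m) (ht.2.trans hbT) ht.1 (abs_nonneg m)

section Trajectory

variable {τ : ℕ → ℝ}

lemma exists_mem_Ico_succ (hτ0 : τ 0 = 0) (hτ : Tendsto τ atTop atTop) {t : ℝ} (ht : 0 ≤ t) :
    ∃ z, t ∈ Ico (τ z) (τ (z + 1)) := by
  have hex : ∃ z, t < τ z := (hτ.eventually_gt_atTop t).exists
  obtain ⟨z, hz⟩ : ∃ z, Nat.find hex = z + 1 := by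
    refine Nat.exists_eq_succ_of_ne_zero fun h0 => ?_
    have := Nat.find_spec hex
    rw [h0, hτ0] at this
    linarith
  have h1 := Nat.find_spec hex
  rw [hz] at h1
  exact ⟨z, not_lt.1 (Nat.find_min hex (by omega)), h1⟩

lemma index_le_of_mem_Ico_succ (hτ : StrictMono τ) {t : ℝ} {z z' : ℕ}
    (h : τ z ≤ t) (h' : t ∈ Ico (τ z') (τ (z' + 1))) : z ≤ z' :=
  Nat.lt_succ_iff.1 (hτ.lt_iff_lt.1 (h.trans_lt h'.2))

lemma exists_isTrajectory (hτ0 : τ 0 = 0) (hτ : StrictMono τ) (hτt : Tendsto τ atTop atTop)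
    (hsol : ∀ z y, ∃ x : ℝ → Vec nx, x 0 = y ∧ ∀ t ∈ Icc 0 (τ (z + 1) - τ z),
      HasDerivWithinAt x (fp (x t) (κ y)) (Icc 0 (τ (z + 1) - τ z)) t) (x₀ : Vec nx) :
    ∃ x e, IsTrajectory fp κ τ x₀ x e := by
  choose X hX0 hX using hsol
  have hidx : ∀ t : ℝ, 0 ≤ t → ∃ z, t ∈ Ico (τ z) (τ (z + 1)) :=
    fun t ht => exists_mem_Ico_succ hτ0 hτt ht
  choose! idx hidx using hidx
  -- `y z` is the state at `τ z`, the endpoint of the previous held-input piece.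
  let y : ℕ → Vec nx := fun z => Nat.rec x₀ (fun z y => X z y (τ (z + 1) - τ z)) z
  have hy : ∀ z, y (z + 1) = X z (y z) (τ (z + 1) - τ z) := fun z => rfl
  have hτn : ∀ z, 0 ≤ τ z := fun z => hτ0 ▸ hτ.monotone z.zero_le
  have hlt : ∀ z, τ z < τ (z + 1) := fun z => hτ z.lt_succ_self
  have hidx_eq : ∀ z, ∀ t ∈ Ico (τ z) (τ (z + 1)), idx t = z := fun z t ht => by
    have h1 := hidx t ((hτn z).trans ht.1)
    exact le_antisymm (index_le_of_mem_Ico_succ hτ h1.1 ht) (index_le_of_mem_Ico_succ hτ ht.1 h1)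
  let x : ℝ → Vec nx := fun t => X (idx t) (y (idx t)) (t - τ (idx t))
  let e : ℝ → Vec nx := fun t => y (idx t) - x t
  have hx : ∀ z, EqOn x (fun t => X z (y z) (t - τ z)) (Ico (τ z) (τ (z + 1))) := fun z t ht => by
    simp only [x, hidx_eq z t ht]
  have he : ∀ z, EqOn e (fun t => y z - x t) (Ico (τ z) (τ (z + 1))) := fun z t ht => by
    simp only [e, hidx_eq z t ht]
  have hxτ : ∀ z, x (τ z) = y z := fun z => by
    rw [hx z (left_mem_Ico.2 (hlt z))]
    simp [hX0]
  have heτ : ∀ z, e (τ z) = 0 := fun z => by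
    rw [he z (left_mem_Ico.2 (hlt z))]
    simp [hxτ]
  have hflow : ∀ z, ∀ t ∈ Ico (τ z) (τ (z + 1)),
      HasDerivWithinAt x (fp (x t) (κ (y z))) (Ico (τ z) (τ (z + 1))) t := fun z t ht => by
    have h1 := hX z (y z) (t - τ z) ⟨by linarith [ht.1], by linarith [ht.2]⟩
    have hmaps : MapsTo (fun s => s - τ z) (Ico (τ z) (τ (z + 1))) (Icc 0 (τ (z + 1) - τ z)) :=
      fun s hs => ⟨by linarith [hs.1], by linarith [hs.2]⟩
    have h2 := h1.scomp t ((hasDerivWithinAt_id t _).sub_const (τ z)) hmaps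
    rw [one_smul] at h2
    rw [hx z ht]
    exact h2.congr (hx z) (hx z ht)
  refine ⟨x, e, ?_, ?_, fun z t ht => ?_, fun z t ht => ?_, fun z => ?_, fun z => heτ _⟩
  · have := hxτ 0
    rwa [hτ0] at this
  · have := heτ 0
    rwa [hτ0] at this
  · rw [f, he z ht, add_sub_cancel]
    exact hflow z t ht
  · rw [g, he z ht, add_sub_cancel]
    exact ((hflow z t ht).const_sub (y z)).congr (he z) (he z ht)
  · rw [hxτ, hy]
    have hT : 0 ≤ τ (z + 1) - τ z := by linarith [hlt z]
    have h1 := (hX z (y z) _ (right_mem_Icc.2 hT)).continuousWithinAt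
    have h2 : Tendsto (fun t => t - τ z) (𝓝[<] (τ (z + 1)))
        (𝓝[Icc 0 (τ (z + 1) - τ z)] (τ (z + 1) - τ z)) := by
      refine tendsto_nhdsWithin_iff.2
        ⟨(continuous_id.sub continuous_const).continuousWithinAt, ?_⟩
      filter_upwards [Ioo_mem_nhdsLT (hlt z)] with t ht
      exact ⟨by linarith [ht.1], by linarith [ht.2]⟩
    refine (h1.tendsto.comp h2).congr' ?_
    filter_upwards [Ioo_mem_nhdsLT (hlt z)] with t ht
    exact (hx z ⟨ht.1.le, ht.2⟩).symm

variable {x₀ : Vec nx} {x e : ℝ → Vec nx}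

lemma IsTrajectory.err_transTime (h : IsTrajectory fp κ τ x₀ x e) (hτ0 : τ 0 = 0) (z : ℕ) :
    e (τ z) = 0 := by
  cases z with
  | zero => rw [hτ0, h.init_e]
  | succ z => exact h.jump_e z

/-- `f + g = 0` makes `x + e` constant between transmissions, and `e` vanishes at `τ z`. -/
lemma IsTrajectory.add_err (h : IsTrajectory fp κ τ x₀ x e) (hτ0 : τ 0 = 0) {z : ℕ} {t : ℝ}
    (ht : t ∈ Ico (τ z) (τ (z + 1))) : x t + e t = x (τ z) := by
  have hd : ∀ s ∈ Ico (τ z) (τ (z + 1)),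
      HasDerivWithinAt (fun s => x s + e s) 0 (Ico (τ z) (τ (z + 1))) s := fun s hs => by
    exact ((h.flow_x z s hs).add (h.flow_e z s hs)).congr_deriv (by simp [f, g])
  have := constant_of_has_deriv_right_zero (f := fun s => x s + e s) (a := τ z) (b := t)
    (fun s hs => ((hd s ⟨hs.1, hs.2.trans_lt ht.2⟩).continuousWithinAt).mono
      (Icc_subset_Ico_right ht.2))
    (fun s hs => (hd s ⟨hs.1, hs.2.trans ht.2⟩).mono_of_mem_nhdsWithin
      (mem_of_superset (Ico_mem_nhdsGE (hs.2.trans ht.2)) (Ico_subset_Ico_left hs.1)))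
    t (right_mem_Icc.2 ht.1)
  simpa [h.err_transTime hτ0] using this

lemma IsTrajectory.continuousOn (h : IsTrajectory fp κ τ x₀ x e) (z : ℕ) :
    ContinuousOn x (Icc (τ z) (τ (z + 1))) := by
  intro t ht
  rcases ht.2.lt_or_eq with hlt | rfl
  · refine (h.flow_x z t ⟨ht.1, hlt⟩).continuousWithinAt.mono_of_mem_nhdsWithin ?_
    exact mem_of_superset (inter_mem_nhdsWithin _ (Iio_mem_nhds hlt)) fun s hs => ⟨hs.1.1, hs.2⟩
  · have : ContinuousWithinAt x (Iio (τ (z + 1))) (τ (z + 1)) := h.jump_x z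
    exact (continuousWithinAt_Iio_iff_Iic.1 this).mono fun s hs => hs.2

lemma IsTrajectory.le_of_holdRate (h : IsTrajectory fp κ τ x₀ x e) (hτ0 : τ 0 = 0) {z : ℕ} {m : ℝ}
    (hm : HoldRate fp κ V (τ (z + 1) - τ z) m) {t : ℝ} (ht : t ∈ Icc (τ z) (τ (z + 1))) :
    V (x t) ≤ V (x (τ z)) * Real.exp (m * (t - τ z)) := by
  refine hm x _ _ le_rfl (h.continuousOn z) (fun s hs => ?_) t ht
  have := h.flow_x z s hs
  rw [f, h.add_err hτ0 hs] at this
  exact this.mono_of_mem_nhdsWithin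
    (mem_of_superset (Ioo_mem_nhdsGT hs.2) fun r hr => ⟨hs.1.trans hr.1.le, hr.2⟩)

lemma IsTrajectory.le_exp_sum (h : IsTrajectory fp κ τ x₀ x e) (hτ0 : τ 0 = 0)
    (hτ : Monotone τ) {m : ℕ → ℝ} (hm : ∀ z, HoldRate fp κ V (τ (z + 1) - τ z) (m z)) (z : ℕ) :
    V (x (τ z)) ≤ V (x 0) *
      Real.exp (∑ i ∈ Finset.range z, m i * (τ (i + 1) - τ i)) := by
  induction z with
  | zero => simp [hτ0]
  | succ z ih =>
    rw [Finset.sum_range_succ, Real.exp_add, ← mul_assoc]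
    exact (h.le_of_holdRate hτ0 (hm z) (right_mem_Icc.2 (hτ z.le_succ))).trans
      (mul_le_mul_of_nonneg_right ih (Real.exp_pos _).le)

/-- `M` bounds the growth of the exponent within one interval and `B - d * z` the sum up to `τ z`,
so `V` stays below `V (x 0) * exp (M + B - d * z)` on the `z`-th interval. -/
lemma isGAS_of_holdRate (hfp : ContDiff ℝ 1 fun y : Vec nx × Vec nu => fp y.1 y.2)
    (hV : StabilizingFeedback fp κ V) (hτ0 : τ 0 = 0) (hτ : StrictMono τ)
    (hτt : Tendsto τ atTop atTop) {m : ℕ → ℝ}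
    (hm : ∀ z, HoldRate fp κ V (τ (z + 1) - τ z) (m z)) {M B d : ℝ} (hd : 0 < d)
    (hM : ∀ z, |m z| * (τ (z + 1) - τ z) ≤ M)
    (hB : ∀ z : ℕ, ∑ i ∈ Finset.range z, m i * (τ (i + 1) - τ i) ≤ B - d * z) :
    IsGAS fp κ τ := by
  have hlt : ∀ z, τ z < τ (z + 1) := fun z => hτ z.lt_succ_self
  have hbound : ∀ x₀ x e, IsTrajectory fp κ τ x₀ x e → ∀ z, ∀ t ∈ Icc (τ z) (τ (z + 1)),
      V (x t) ≤ V (x 0) * Real.exp (M + B - d * z) := by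
    intro x₀ x e h z t ht
    have h1 := h.le_of_holdRate hτ0 (hm z) ht
    have h2 := h.le_exp_sum hτ0 hτ.monotone hm z
    have h3 : m z * (t - τ z) ≤ M :=
      (mul_le_mul (le_abs_self _) (by linarith [ht.2]) (by linarith [ht.1])
        (abs_nonneg _)).trans (hM z)
    have h4 : Real.exp (M + B - d * z) = Real.exp (B - d * z) * Real.exp M := by
      rw [← Real.exp_add]
      ring_nf
    rw [h4, ← mul_assoc]
    refine h1.trans (mul_le_mul (h2.trans ?_) (Real.exp_le_exp.2 h3) (Real.exp_pos _).le ?_)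
    · exact mul_le_mul_of_nonneg_left (Real.exp_le_exp.2 (hB z)) (hV.nonneg _)
    · exact mul_nonneg (hV.nonneg _) (Real.exp_pos _).le
  have hsmall : ∀ β > 0, ∃ ζ > 0, ∀ x₀ x e, IsTrajectory fp κ τ x₀ x e →
      ∀ z : ℕ, V (x 0) * Real.exp (M + B - d * z) < ζ → ∀ t ∈ Ico (τ z) (τ (z + 1)),
        ‖stack (x t) (e t)‖ < β := by
    intro β hβ
    -- A third of `β`, since `‖ξ‖ ≤ ‖x t‖ + ‖e t‖ ≤ 2 ‖x t‖ + ‖x (τ z)‖`.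
    obtain ⟨ζ, hζ, hζV⟩ := hV.exists_norm_lt (show 0 < β / 3 by linarith)
    refine ⟨ζ, hζ, fun x₀ x e h z hz t ht => ?_⟩
    have h1 := hζV _ ((hbound x₀ x e h z t (Ico_subset_Icc_self ht)).trans_lt hz)
    have h2 := hζV _ ((hbound x₀ x e h z _ (left_mem_Icc.2 (hlt z).le)).trans_lt hz)
    have h3 : e t = x (τ z) - x t := by rw [← h.add_err hτ0 ht, add_sub_cancel_left]
    have h4 := norm_sub_le (x (τ z)) (x t)
    rw [← h3] at h4
    linarith [norm_stack_le (x t) (e t)]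
  refine ⟨?_, fun β hβ => ?_, fun x₀ x e h => ?_⟩
  · exact exists_isTrajectory hτ0 hτ hτt fun z y =>
      (hm z).exists_solution hfp hV (by linarith [hlt z]) y
  · obtain ⟨ζ, hζ, hst⟩ := hsmall β hβ
    have hcont : ContinuousAt (fun x => V x * Real.exp (M + B)) 0 :=
      (hV.posDef.1.mul continuous_const).continuousAt
    have hev := hcont.eventually_lt_const (u := ζ) (by simpa [hV.posDef.2.1] using hζ)
    obtain ⟨δ, hδ, hball⟩ := Metric.nhds_basis_closedBall.mem_iff.1 hev
    refine ⟨δ, hδ, fun x₀ x e h hδx t ht => ?_⟩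
    obtain ⟨z, hz⟩ := exists_mem_Ico_succ hτ0 hτt ht
    have h1 : V (x 0) * Real.exp (M + B) < ζ :=
      hball (mem_closedBall_zero_iff.2 ((norm_le_norm_stack _ _).trans hδx))
    refine (hst x₀ x e h z (lt_of_le_of_lt ?_ h1) t hz).le
    refine mul_le_mul_of_nonneg_left (Real.exp_le_exp.2 ?_) (hV.nonneg _)
    have : 0 ≤ d * z := by positivity
    linarith
  · rw [NormedAddGroup.tendsto_nhds_zero]
    intro β hβ
    obtain ⟨ζ, hζ, hst⟩ := hsmall β hβ
    have hlim : Tendsto (fun z : ℕ => V (x 0) * Real.exp (M + B - d * z)) atTop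
        (𝓝 (V (x 0) * 0)) := by
      refine (Real.tendsto_exp_atBot.comp ?_).const_mul _
      exact tendsto_atBot_add_const_left _ _
        (tendsto_neg_atTop_atBot.comp (tendsto_natCast_atTop_atTop.const_mul_atTop hd))
    rw [mul_zero] at hlim
    obtain ⟨Z, hZ⟩ := eventually_atTop.1 (hlim.eventually_lt_const hζ)
    filter_upwards [eventually_ge_atTop (τ Z)] with t ht
    obtain ⟨z, hz⟩ := exists_mem_Ico_succ hτ0 hτt
      ((hτ0 ▸ hτ.monotone Z.zero_le : (0 : ℝ) ≤ τ Z).trans ht)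
    exact hst x₀ x e h z (hZ z (index_le_of_mem_Ico_succ hτ ht hz)) t hz

end Trajectory

end Stability

end WHRT

end

theorem theorem1
    {nx nu : ℕ}
    (fp : WHRT.Vec nx → WHRT.Vec nu → WHRT.Vec nx)
    (hfp : ContDiff ℝ 1 (fun y : WHRT.Vec nx × WHRT.Vec nu => fp y.1 y.2))
    (hfp0 : fp 0 0 = 0)
    (κ : WHRT.Vec nx → WHRT.Vec nu)
    (V : WHRT.Vec nx → ℝ)
    (hV : WHRT.StabilizingFeedback fp κ V)
    (h : ℝ) (hh : 0 < h)
    (η : WHRT.Constraint)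
    (G : WHRT.LabeledDigraph) (hG : G.IsWHRTGraph η)
    (c : ℕ) (hc : 0 < c)
    (γ L Λ ε : ℕ → ℝ)
    (hparam : ∀ i : ℕ, 1 ≤ i → (i : ℕ∞) ≤ WHRT.maxLost η + 1 →
      WHRT.EmulationAssumption fp κ V (γ i) (L i) (ε i) ∧ 0 < Λ i ∧
        i * h < WHRT.Tmax (γ i) (Λ i))
    (hsum : ∀ P ∈ G.walksOfCost c,
      (P.map fun p => h * G.weight p *
        max (- ε (G.weight p)) (2 * (L (G.weight p) - Λ (G.weight p)))).sum < 0) :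
    ∀ η' : WHRT.Constraint, WHRT.Harder η' η →
      ∀ ν : ℕ → Bool, η' ν → ν 0 = true →
        WHRT.IsGAS fp κ (WHRT.transTime h ν) := by
  intro η' hη' ν hν hν0
  have hην := hη' ν hν
  obtain ⟨P, hP, hPν⟩ := hG ν hην hν0
  obtain ⟨B, d, hd, hB⟩ := G.exists_sum_le_sub_mul hc hsum
  have hτ : ∀ z, WHRT.transTime h ν z = h * (∑ i ∈ Finset.range z, G.weight (P i) : ℕ) :=
    fun z => by rw [WHRT.transTime, hPν.nth_eq_sum]
  have hstep : ∀ z, WHRT.transTime h ν (z + 1) - WHRT.transTime h ν z = h * G.weight (P z) :=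
    fun z => by
      rw [hτ, hτ, Finset.sum_range_succ]
      push_cast
      ring
  have hmono := WHRT.LabeledDigraph.strictMono_sum_weight G P
  -- A uniform `M` exists because the graph has finitely many edges.
  obtain ⟨M, hM⟩ := (finite_range fun p => |max (- ε (G.weight p))
    (2 * (L (G.weight p) - Λ (G.weight p)))| * (h * G.weight p)).bddAbove
  refine WHRT.isGAS_of_holdRate hfp hV (m := fun z => max (- ε (G.weight (P z)))
    (2 * (L (G.weight (P z)) - Λ (G.weight (P z))))) (M := M) (B := B) ?_ ?_ ?_ ?_ hd ?_ ?_
  · simp [hτ]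
  · intro z z' hz
    rw [hτ, hτ]
    exact mul_lt_mul_of_pos_left (by exact_mod_cast hmono hz) hh
  · simp_rw [funext hτ]
    exact (tendsto_natCast_atTop_atTop.comp hmono.tendsto_atTop).const_mul_atTop hh
  · intro z x a b hab hxc hxd
    obtain ⟨hem, hΛ, hT⟩ := hparam _ (G.weight_pos (P z)) (hPν.weight_le_maxLost hην z)
    rw [hstep, mul_comm] at hab
    exact WHRT.storage_bound hfp.continuous hV hem hΛ hT hab hxc hxd
  · intro z
    rw [hstep]
    exact hM (mem_range_self (P z))
  · intro z
    refine le_of_eq_of_le (Finset.sum_congr rfl fun i _ => ?_) (hB z P hP)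
    rw [hstep, mul_comm]
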